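/- Let $\mathfrak A$ be a unital C*-algebra, $\Phi:\mathfrak A\to\mathfrak A$ a unital completely positive map and $\varphi$ a state on $\mathfrak A$ with $\varphi\circ\Phi=\varphi$. Let $(\mathcal H_\varphi,\pi_\varphi,\Omega_\varphi)$ be the GNS representation of $\varphi$, and let $\mathbf U_{\Phi,\varphi}$ be the unique linear contraction on $\mathcal H_\varphi$ such that $\mathbf U_{\Phi,\varphi}\pi_\varphi(a)\Omega_\varphi=\pi_\varphi(\Phi(a))\Omega_\varphi$ for all $a\in\mathfrak A$. Representations are unital $*$-homomorphisms into $\mathcal B(\mathcal H)$, and inner products are linear in the second variable. Then there exist a Hilbert space $\mathcal H_\infty$, a linear isometry $\mathbf Z_0:\mathcal H_\varphi\to\mathcal H_\infty$, a representation $\pi_\infty:\mathfrak A\to\mathcal B(\mathcal H_\infty)$ with $\pi_\infty(a)\mathbf Z_0=\mathbf Z_0\pi_\varphi(a)$ for all $a\in\mathfrak A$, the vector $\Omega_\infty=\mathbf Z_0\Omega_\varphi$, and a linear isometry $\mathbf V_\infty\in\mathcal B(\mathcal H_\infty)$ such that: 1. $\mathbf V_\infty$ is an isometric dilation of $\mathbf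 U_{\Phi,\varphi}^*$, i.e. $(\mathbf U_{\Phi,\varphi}^{*})^{n}=\mathbf Z_0^*\mathbf V_\infty^n\mathbf Z_0$ for all $n\in\mathbb N=\{0,1,2,\dots\}$, and $\mathbf V_\infty\Omega_\infty=\Omega_\infty$; 2. $\Omega_\infty$ is cyclic for the $*$-subalgebra of $\mathcal B(\mathcal H_\infty)$ generated by $\bigcup_{n\ge0}\{\mathbf V_\infty^n\pi_\infty(a)\mathbf V_\infty^{*n}:a\in\mathfrak A\}$; 3. $\pi_\infty(\Phi(a))=\mathbf V_\infty^*\pi_\infty(a)\mathbf V_\infty$ and $\varphi(a)=\langle\Omega_\infty,\pi_\infty(a)\Omega_\infty\rangle$ for all $a\in\mathfrak A$. The quadruple $(\pi_\infty,\mathcal H_\infty,\Omega_\infty,\mathbf V_\infty)$ is uniquely determined by properties 1–3 up to unitary equivalence: if $\mathcal H$ is a Hilbert space, $\pi:\mathfrak A\to\mathcal B(\mathcal H)$ a representation, $\Omega\in\mathcal H$, and $\mathbf V$ a linear isometry on $\mathcal H$ such that 1–3 hold for $(\pi,\mathcal H,\Omega,\mathbf V)$ with some linear isometry $\mathbf Z:\mathcal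 H_\varphi\to\mathcal H$ in place of $\mathbf Z_0$, then there is a unitary $\mathbf W:\mathcal H_\infty\to\mathcal H$ with $\mathbf W\Omega_\infty=\Omega$, $\mathbf W\pi_\infty(a)=\pi(a)\mathbf W$ for all $a\in\mathfrak A$, and $\mathbf W\mathbf V_\infty=\mathbf V\mathbf W$. -/

import Mathlib

open scoped ComplexOrder CStarAlgebra

universe u v

noncomputable section

namespace CovariantGNS

variable {A : Type*} [CStarAlgebra A] [PartialOrder A] [StarOrderedRing A]

/-- The canonical cyclic vector `Ω_φ` of the GNS space: the class of the unit of `A`. -/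
def gnsVector (φ : A →ₚ[ℂ] ℂ) : φ.GNS := ((φ.toPreGNS 1 : φ.PreGNS) : φ.GNS)

/-- The Kadison–Schwarz inequality for unital completely positive maps. -/
lemma kadison_schwarz (Φ : A →CP A) (hΦ : Φ 1 = 1) (a : A) :
    star (Φ a) * Φ a ≤ Φ (star a * a) := by
  let R : CStarMatrix (Fin 2) (Fin 2) A := CStarMatrix.ofMatrix !![1, a; 0, 0]
  have hN : 0 ≤ (star R * R).map Φ :=
    CompletelyPositiveMap.map_cstarMatrix_nonneg Φ _ (star_mul_self_nonneg R)
  have hstar : Φ (star a) = star (Φ a) := map_star Φ a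
  let C : CStarMatrix (Fin 2) (Fin 2) A := CStarMatrix.ofMatrix !![-Φ a, 0; 1, 0]
  have hC : 0 ≤ star C * (star R * R).map Φ * C := star_left_conjugate_nonneg hN C
  have hdiag : ∀ M : CStarMatrix (Fin 2) (Fin 2) A, 0 ≤ M → 0 ≤ M 0 0 := by
    intro M hM
    rw [StarOrderedRing.nonneg_iff] at hM
    induction hM using AddSubmonoid.closure_induction with
    | mem x hx =>
      obtain ⟨S, rfl⟩ := hx
      simp only [CStarMatrix.mul_apply, CStarMatrix.star_apply]
      exact Finset.sum_nonneg fun i _ => star_mul_self_nonneg _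
    | zero => simp
    | add x y _ _ hx hy => simpa using add_nonneg hx hy
  have h00 := hdiag _ hC
  have hR : (star C * (star R * R).map Φ * C) 0 0 = Φ (star a * a) - star (Φ a) * Φ a := by
    simp [CStarMatrix.mul_apply, CStarMatrix.star_apply, Fin.sum_univ_two, R, C, hΦ, hstar]
    abel
  rwa [hR, sub_nonneg] at h00

/-- The map `a ↦ Φ a`, seen as a contraction of the pre-Hilbert space `A` with the semi-inner
product `⟪a, b⟫ = φ (a⋆ b)`. -/
def preContraction (Φ : A →CP A) (φ : A →ₚ[ℂ] ℂ) (hΦ : Φ 1 = 1)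
    (hinv : ∀ a, φ (Φ a) = φ a) : φ.PreGNS →L[ℂ] φ.PreGNS :=
  (φ.toPreGNS.toLinearMap ∘ₗ Φ.toLinearMap ∘ₗ φ.ofPreGNS.toLinearMap).mkContinuous 1 fun x => by
    rw [one_mul, PositiveLinearMap.preGNS_norm_def, PositiveLinearMap.preGNS_norm_def]
    refine Real.sqrt_le_sqrt ?_
    have h := OrderHomClass.mono φ (kadison_schwarz Φ hΦ (φ.ofPreGNS x))
    rw [hinv] at h
    exact (Complex.le_def.mp h).1

/-- The contraction `U_{Φ,φ}` of the GNS space, determined by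
`U_{Φ,φ} (π_φ(a) Ω_φ) = π_φ(Φ(a)) Ω_φ`. -/
def gnsContraction (Φ : A →CP A) (φ : A →ₚ[ℂ] ℂ) (hΦ : Φ 1 = 1)
    (hinv : ∀ a, φ (Φ a) = φ a) : φ.GNS →L[ℂ] φ.GNS :=
  (preContraction Φ φ hΦ hinv).completion

lemma gnsStarAlgHom_gnsVector (φ : A →ₚ[ℂ] ℂ) (a : A) :
    φ.gnsStarAlgHom a (gnsVector φ) = ((φ.toPreGNS a : φ.PreGNS) : φ.GNS) := by
  simp [gnsVector]

/-- The defining relation of `U_{Φ,φ}`. -/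
lemma gnsContraction_apply (Φ : A →CP A) (φ : A →ₚ[ℂ] ℂ) (hΦ : Φ 1 = 1)
    (hinv : ∀ a, φ (Φ a) = φ a) (a : A) :
    gnsContraction Φ φ hΦ hinv (φ.gnsStarAlgHom a (gnsVector φ)) =
      φ.gnsStarAlgHom (Φ a) (gnsVector φ) := by
  rw [gnsStarAlgHom_gnsVector, gnsStarAlgHom_gnsVector, gnsContraction,
    ContinuousLinearMap.completion_apply_coe]
  rfl

variable {H : Type*} [NormedAddCommGroup H] [InnerProductSpace ℂ H] [CompleteSpace H]

/-- The triple `(H, π, Ω)` extends the GNS triple of `φ` along the isometry `Z`. -/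
structure ExtendsGNS (φ : A →ₚ[ℂ] ℂ) (Z : φ.GNS →ₗᵢ[ℂ] H)
    (π : A →⋆ₐ[ℂ] (H →L[ℂ] H)) (Ω : H) : Prop where
  intertwines : ∀ a, π a ∘L Z.toContinuousLinearMap = Z.toContinuousLinearMap ∘L φ.gnsStarAlgHom a
  vector_eq : Ω = Z (gnsVector φ)

/-- `(V, H, Z)` is an isometric dilation of the operator `T` on `K`. -/
structure IsIsometricDilation {K : Type*} [NormedAddCommGroup K] [InnerProductSpace ℂ K]
    [CompleteSpace K] (T : K →L[ℂ] K) (Z : K →ₗᵢ[ℂ] H) (V : H →L[ℂ] H) : Prop where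
  isometry : Isometry V
  pow_eq : ∀ n : ℕ, T ^ n =
    ContinuousLinearMap.adjoint Z.toContinuousLinearMap ∘L (V ^ n) ∘L Z.toContinuousLinearMap

/-- The star subalgebra of `B(H)` generated by all `V ^ n π(a) V⋆ ^ n`. -/
def orbitAlgebra (π : A →⋆ₐ[ℂ] (H →L[ℂ] H)) (V : H →L[ℂ] H) :
    StarSubalgebra ℂ (H →L[ℂ] H) :=
  StarAlgebra.adjoin ℂ {T | ∃ (n : ℕ) (a : A), T = V ^ n * π a * star V ^ n}

/-- `Ω` is cyclic for the star subalgebra `B` of `B(H)`. -/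
def IsCyclic (B : StarSubalgebra ℂ (H →L[ℂ] H)) (Ω : H) : Prop :=
  Dense {x : H | ∃ T ∈ B, x = T Ω}

/-- The characteristic properties of the covariant GNS quadruple `(π, H, Ω, V)`, the embedding of
the GNS space used for the dilation being `Z`. -/
structure IsCovariant (Φ : A →CP A) (φ : A →ₚ[ℂ] ℂ) (hΦ : Φ 1 = 1)
    (hinv : ∀ a, φ (Φ a) = φ a) (Z : φ.GNS →ₗᵢ[ℂ] H)
    (π : A →⋆ₐ[ℂ] (H →L[ℂ] H)) (Ω : H) (V : H →L[ℂ] H) : Prop where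
  dilation : IsIsometricDilation
    (ContinuousLinearMap.adjoint (gnsContraction Φ φ hΦ hinv)) Z V
  fixes : V Ω = Ω
  cyclic : IsCyclic (orbitAlgebra π V) Ω
  covariant : ∀ a, π (Φ a) = star V * π a * V
  state_eq : ∀ a, φ a = inner ℂ Ω (π a Ω)

end CovariantGNS

end

/-! Existence. Write `U` for the GNS contraction. The defect `a ↦ π_φ(Φ a) - U π_φ(a) U⋆` is
completely positive (`posSemidef_starKernel_defectMap`), so it has a minimal Stinespring dilation
`(σ₁, D₀)`. Dilating `σ₁ ∘ Φ`, and then each `σₙ ∘ Φ` in turn, gives a tower of representations `σₙ`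
on `Gₙ` with maps `Dₙ : Gₙ → Gₙ₊₁`, where `G₀` is the GNS space. On the Hilbert sum put `π = ⊕ σₙ`
and `V(x₀, x₁, …) = (U⋆ x₀, D₀ x₀, D₁ x₁, …)`. Then `V⋆ π(a) V` is diagonal, and the choice of `D₀`
and `Dₙ` makes its entries `σₙ(Φ a)`. The case `a = 1` says that `V` is an isometry; minimality at
each level gives cyclicity (`exists_isometry_of_tower`). The dilation property follows from
covariance and `V Ω = Ω`.

Uniqueness. Words in the operators `Vⁿ π(a) V⋆ⁿ`, applied to `Ω`, span a dense subspace. Their Gram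
matrix consists of vacuum expectations of words. Since `V Ω = Ω`, a word may be replaced by its
compression `V⋆ (·) V`, which covariance rewrites as a word of lower level. At level zero only `φ`
remains, so the Gram matrix depends on `Φ` and `φ` alone (`IsCovariant.inner_wordOp_eq`). -/

open InnerProductSpace

namespace CovariantGNS

/-! ### Total families and their Gram matrices -/

section TotalFamilies

variable {X E F : Type*} [NormedAddCommGroup E] [InnerProductSpace ℂ E]
  [NormedAddCommGroup F] [InnerProductSpace ℂ F]

/-- The linear span of `s` is dense. -/
def IsTotal (s : Set E) : Prop := Dense (Submodule.span ℂ s : Set E)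

lemma IsTotal.induction {s : Set E} (hs : IsTotal s) (K : Submodule ℂ E)
    (hK : IsClosed (K : Set E)) (h : s ⊆ K) : K = ⊤ := by
  rw [eq_top_iff, ← Submodule.dense_iff_topologicalClosure_eq_top.1 hs]
  exact Submodule.topologicalClosure_minimal _ (Submodule.span_le.2 h) hK

lemma IsTotal.clm_ext {s : Set E} (hs : IsTotal s) {S T : E →L[ℂ] F}
    (h : ∀ x ∈ s, S x = T x) : S = T :=
  ContinuousLinearMap.ext_on hs h

lemma IsTotal.ext_inner {s : Set E} (hs : IsTotal s) {x y : E}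
    (h : ∀ z ∈ s, ⟪z, x⟫_ℂ = ⟪z, y⟫_ℂ) : x = y := by
  have := hs.clm_ext (S := innerSL ℂ x) (T := innerSL ℂ y) fun z hz => by
    rw [innerSL_apply_apply, innerSL_apply_apply, ← inner_conj_symm, h z hz, inner_conj_symm]
  exact ext_inner_right ℂ fun z => congrArg (fun S : E →L[ℂ] ℂ => S z) this

lemma IsTotal.clm_ext_inner {s : Set E} {t : Set F} (hs : IsTotal s) (ht : IsTotal t)
    {S T : E →L[ℂ] F} (h : ∀ y ∈ t, ∀ x ∈ s, ⟪y, S x⟫_ℂ = ⟪y, T x⟫_ℂ) : S = T :=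
  hs.clm_ext fun x hx => ht.ext_inner fun y hy => h y hy x hx

lemma IsTotal.denseRange {k : X → E} (hk : IsTotal (Set.range k)) :
    DenseRange (Finsupp.linearCombination ℂ k) := by
  rw [IsTotal, ← Finsupp.range_linearCombination] at hk
  exact hk

/-- The bound makes `∑ cₓ k x ↦ ∑ cₓ k' x` well defined even when `k` is linearly dependent; density
then extends it to `E`. -/
lemma exists_clm_of_norm_le [CompleteSpace F] {k : X → E} (hk : IsTotal (Set.range k)) (k' : X → F)
    (C : ℝ) (h : ∀ f, ‖Finsupp.linearCombination ℂ k' f‖ ≤ C * ‖Finsupp.linearCombination ℂ k f‖) :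
    ∃ T : E →L[ℂ] F, ∀ x, T (k x) = k' x := by
  refine ⟨(Finsupp.linearCombination ℂ k').extendOfNorm (Finsupp.linearCombination ℂ k),
    fun x => ?_⟩
  have := LinearMap.extendOfNorm_eq (f := Finsupp.linearCombination ℂ k') hk.denseRange ⟨C, h⟩
    (Finsupp.single x 1)
  simpa using this

lemma inner_linearCombination (k k' : X → E) (f g : X →₀ ℂ) :
    ⟪Finsupp.linearCombination ℂ k f, Finsupp.linearCombination ℂ k' g⟫_ℂ =
      f.sum fun x c => g.sum fun y d => star c * d * ⟪k x, k' y⟫_ℂ := by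
  simp only [Finsupp.linearCombination_apply, Finsupp.sum_inner, Finsupp.inner_sum,
    inner_smul_left, inner_smul_right, Finsupp.mul_sum]
  rw [Finsupp.sum_comm]
  simp only [RCLike.star_def, mul_left_comm, mul_assoc]

/-- Two total families with the same Gram matrix are unitarily equivalent. -/
lemma exists_linearIsometryEquiv_of_inner_eq [CompleteSpace E] [CompleteSpace F]
    {k : X → E} {k' : X → F} (hk : IsTotal (Set.range k)) (hk' : IsTotal (Set.range k'))
    (h : ∀ x y, ⟪k x, k y⟫_ℂ = ⟪k' x, k' y⟫_ℂ) :
    ∃ W : E ≃ₗᵢ[ℂ] F, ∀ x, W (k x) = k' x := by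
  have hnorm : ∀ f, ‖Finsupp.linearCombination ℂ k f‖ = ‖Finsupp.linearCombination ℂ k' f‖ := by
    intro f
    rw [@norm_eq_sqrt_re_inner ℂ, @norm_eq_sqrt_re_inner ℂ F, inner_linearCombination,
      inner_linearCombination]
    simp only [h]
  obtain ⟨S, hS⟩ := exists_clm_of_norm_le hk k' 1 fun f => by rw [hnorm, one_mul]
  obtain ⟨T, hT⟩ := exists_clm_of_norm_le hk' k 1 fun f => by rw [hnorm, one_mul]
  have hTS : T ∘L S = .id ℂ E := hk.clm_ext (by rintro _ ⟨x, rfl⟩; simp [hS, hT])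
  have hST : S ∘L T = .id ℂ F := hk'.clm_ext (by rintro _ ⟨x, rfl⟩; simp [hS, hT])
  have hadj : ContinuousLinearMap.adjoint S ∘L S = .id ℂ E := by
    refine hk.clm_ext_inner hk ?_
    rintro _ ⟨y, rfl⟩ _ ⟨x, rfl⟩
    simp [ContinuousLinearMap.adjoint_inner_right, hS, h]
  refine ⟨{ toLinearEquiv := LinearEquiv.ofLinearMap S.toLinearMap T.toLinearMap ?_ ?_,
            norm_map' := ?_ }, hS⟩
  · ext x; exact congrArg (fun R : F →L[ℂ] F => R x) hST
  · ext x; exact congrArg (fun R : E →L[ℂ] E => R x) hTS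
  · exact S.norm_map_iff_adjoint_comp_self.2 hadj

end TotalFamilies

/-! ### Stinespring dilation through reproducing kernels -/

section Stinespring

variable {A : Type*} [CStarAlgebra A] {H K : Type*} [NormedAddCommGroup H] [InnerProductSpace ℂ H]
  [NormedAddCommGroup K] [InnerProductSpace ℂ K] [CompleteSpace K]

lemma starAlgHom_apply_apply (π : A →⋆ₐ[ℂ] (K →L[ℂ] K)) (a b : A) (x : K) :
    π a (π b x) = π (a * b) x := by
  rw [map_mul]; rfl

lemma inner_starAlgHom_left (π : A →⋆ₐ[ℂ] (K →L[ℂ] K)) (a : A) (x y : K) :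
    ⟪π a x, y⟫_ℂ = ⟪x, π (star a) y⟫_ℂ := by
  rw [map_star, ContinuousLinearMap.star_eq_adjoint, ContinuousLinearMap.adjoint_inner_right]

variable [PartialOrder A] [StarOrderedRing A]

lemma cp_map_star (Φ : A →CP A) (a : A) : Φ (star a) = star (Φ a) := map_star Φ a

/-- Left multiplication on a Kolmogorov decomposition of the kernel `(a, b) ↦ T (a⋆ b)` is a
representation. -/
theorem exists_starAlgHom_of_kernel (T : A →ₗ[ℂ] H →L[ℂ] H) (E : A → H → K)
    (hE : ∀ a b x y, ⟪E a x, E b y⟫_ℂ = ⟪x, T (star a * b) y⟫_ℂ)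
    (htot : IsTotal (Set.range fun p : A × H => E p.1 p.2)) :
    ∃ σ : A →⋆ₐ[ℂ] (K →L[ℂ] K), ∀ a b x, σ a (E b x) = E (a * b) x := by
  have hbound (a : A) (f : A × H →₀ ℂ) :
      ‖Finsupp.linearCombination ℂ (fun p : A × H => E (a * p.1) p.2) f‖ ≤
        ‖a‖ * ‖Finsupp.linearCombination ℂ (fun p : A × H => E p.1 p.2) f‖ := by
    -- With `‖a‖² - a⋆a = c⋆c`, the squared norms of the combinations shifted by `a` and by `c` add
    -- up to `‖a‖²` times the original one, which gives the bound.
    obtain ⟨c, hc⟩ : ∃ c : A, algebraMap ℝ A (‖a‖ ^ 2) - star a * a = star c * c := by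
      refine CStarAlgebra.nonneg_iff_eq_star_mul_self.1 (sub_nonneg.2 ?_)
      rw [sq, ← CStarRing.norm_star_mul_self]
      exact IsSelfAdjoint.le_algebraMap_norm_self (.star_mul_self a)
    have hkey : ⟪Finsupp.linearCombination ℂ (fun p : A × H => E (a * p.1) p.2) f,
          Finsupp.linearCombination ℂ (fun p : A × H => E (a * p.1) p.2) f⟫_ℂ +
        ⟪Finsupp.linearCombination ℂ (fun p : A × H => E (c * p.1) p.2) f,
          Finsupp.linearCombination ℂ (fun p : A × H => E (c * p.1) p.2) f⟫_ℂ =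
        (‖a‖ ^ 2 : ℂ) * ⟪Finsupp.linearCombination ℂ (fun p : A × H => E p.1 p.2) f,
          Finsupp.linearCombination ℂ (fun p : A × H => E p.1 p.2) f⟫_ℂ := by
      simp only [inner_linearCombination, hE, Finsupp.mul_sum, ← Finsupp.sum_add]
      refine Finsupp.sum_congr fun p _ => Finsupp.sum_congr fun q _ => ?_
      have h : star (a * p.1) * (a * q.1) + star (c * p.1) * (c * q.1) =
          ((‖a‖ : ℂ) ^ 2) • (star p.1 * q.1) := by
        have : star c * c = ((‖a‖ : ℂ) ^ 2) • (1 : A) - star a * a := by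
          rw [← hc, Algebra.algebraMap_eq_smul_one, ← Complex.ofReal_pow, Complex.coe_smul]
        calc _ = star p.1 * (star a * a + star c * c) * q.1 := by simp only [star_mul]; noncomm_ring
          _ = _ := by rw [this]; simp
      rw [← mul_add, ← inner_add_right, ← add_apply, ← map_add, h, map_smul,
        smul_apply, inner_smul_right]
      ring
    simp only [inner_self_eq_norm_sq_to_K, RCLike.ofReal_eq_complex_ofReal] at hkey
    have hkey' : ‖Finsupp.linearCombination ℂ (fun p : A × H => E (a * p.1) p.2) f‖ ^ 2 +
        ‖Finsupp.linearCombination ℂ (fun p : A × H => E (c * p.1) p.2) f‖ ^ 2 =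
        ‖a‖ ^ 2 * ‖Finsupp.linearCombination ℂ (fun p : A × H => E p.1 p.2) f‖ ^ 2 := by
      exact_mod_cast hkey
    refine le_of_sq_le_sq ?_ (by positivity)
    rw [mul_pow, ← hkey']
    exact le_add_of_nonneg_right (by positivity)
  choose σ hσ using fun a => exists_clm_of_norm_le htot (fun p : A × H => E (a * p.1) p.2) ‖a‖
    (hbound a)
  replace hσ (a b x) : σ a (E b x) = E (a * b) x := hσ a (b, x)
  -- `E` is not assumed linear in its first argument, so the algebraic identities are checked on
  -- matrix coefficients, where linearity comes from `T`.
  have hext {S R : K →L[ℂ] K} (h : ∀ a b x y, ⟪E a x, S (E b y)⟫_ℂ = ⟪E a x, R (E b y)⟫_ℂ) :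
      S = R := by
    refine htot.clm_ext_inner htot ?_
    rintro _ ⟨p, rfl⟩ _ ⟨q, rfl⟩
    exact h _ _ _ _
  refine ⟨{ toFun := σ, map_one' := ?_, map_mul' := ?_, map_zero' := ?_, map_add' := ?_,
            commutes' := ?_, map_star' := ?_ }, hσ⟩
  · exact hext fun a b x y => by simp [hσ]
  · exact fun c d => hext fun a b x y => by simp [hσ, mul_assoc]
  · exact hext fun a b x y => by simp [hσ, hE]
  · exact fun c d => hext fun a b x y => by simp [hσ, hE, add_mul, mul_add]
  · exact fun r => hext fun a b x y => by
      simp [hσ, hE, Algebra.algebraMap_eq_smul_one]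
  · exact fun c => hext fun a b x y => by
      simp [hσ, hE, ContinuousLinearMap.star_eq_adjoint, ContinuousLinearMap.adjoint_inner_right,
        mul_assoc]

variable [CompleteSpace H]

/-- The operator-valued kernel `(a, b) ↦ T (a⋆ b)` of a map on a C⋆-algebra. -/
noncomputable def starKernel (T : A →ₗ[ℂ] H →L[ℂ] H) : Matrix A A (H →L[ℂ] H) :=
  .of fun a b => T (star a * b)

/-- Minimal Stinespring dilation of an operator-valued completely positive map. -/
theorem exists_stinespring {A H : Type u} [CStarAlgebra A] [PartialOrder A] [StarOrderedRing A]
    [NormedAddCommGroup H] [InnerProductSpace ℂ H] [CompleteSpace H]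
    (T : A →ₗ[ℂ] H →L[ℂ] H) (hT : (starKernel T).PosSemidef) :
    ∃ (K : Type u) (_ : NormedAddCommGroup K) (_ : InnerProductSpace ℂ K) (_ : CompleteSpace K)
      (σ : A →⋆ₐ[ℂ] (K →L[ℂ] K)) (D : H →L[ℂ] K),
      (∀ a x y, ⟪D x, σ a (D y)⟫_ℂ = ⟪x, T a y⟫_ℂ) ∧
      IsTotal (Set.range fun p : A × H => σ p.1 (D p.2)) := by
  have : Fact (starKernel T).PosSemidef := ⟨hT⟩
  -- The kernel function at `(a, x)` plays the role of `σ(a) D x`; hence `D` is the kernel function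
  -- at `1`.
  let K := RKHS.OfKernel (starKernel T)
  have hE (a b : A) (x y : H) :
      ⟪RKHS.kerFun K a x, RKHS.kerFun K b y⟫_ℂ = ⟪x, T (star a * b) y⟫_ℂ := by
    rw [← RKHS.kernel_inner, RKHS.OfKernel.kernel_ofKernel]
    have := hT.isHermitian.apply b a
    rw [← this, ContinuousLinearMap.star_eq_adjoint, ContinuousLinearMap.adjoint_inner_left]
    rfl
  have htot : IsTotal (Set.range fun p : A × H => RKHS.kerFun K p.1 p.2) := by
    have := RKHS.kerFun_dense K
    rw [← Submodule.dense_iff_topologicalClosure_eq_top] at this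
    have hset : (Set.range fun p : A × H => RKHS.kerFun K p.1 p.2) =
        {RKHS.kerFun K a x | (a) (x)} := by
      ext; simp
    rwa [IsTotal, hset]
  obtain ⟨σ, hσ⟩ := exists_starAlgHom_of_kernel T (fun a x => RKHS.kerFun K a x) hE htot
  refine ⟨K, inferInstance, inferInstance, inferInstance, σ, RKHS.kerFun K 1, ?_, ?_⟩
  · simp [hσ, hE]
  · simpa [hσ] using htot

/-- The composition of a completely positive map with a representation has a positive
semidefinite kernel. -/
theorem posSemidef_starKernel_comp (Φ : A →CP A) (σ : A →⋆ₐ[ℂ] (H →L[ℂ] H)) :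
    (starKernel (σ.toAlgHom.toLinearMap ∘ₗ Φ.toLinearMap)).PosSemidef := by
  classical
  refine ((RKHS.posSemidef_tfae (K := starKernel _)).out 0 2).2 (And.intro ?_ fun w => ?_)
  · ext a b : 1
    change star (σ (Φ (star b * a))) = σ (Φ (star a * b))
    rw [← map_star, ← cp_map_star, star_mul, star_star]
  · rcases w.support.eq_empty_or_nonempty with h0 | ⟨a₀, ha₀⟩
    · simp [Finsupp.sum, h0]
    -- A square matrix whose only nonzero row lists the points of the support, so that `R⋆R` has
    -- entries `aᵢ⋆ aⱼ`. Choosing the row requires a nonempty support.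
    let R : CStarMatrix w.support w.support A :=
      CStarMatrix.ofMatrix fun i j => if i = ⟨a₀, ha₀⟩ then (j : A) else 0
    have hR (i j : w.support) : (star R * R) i j = star (i : A) * j := by
      have hRapp (i j : w.support) : R i j = if i = ⟨a₀, ha₀⟩ then (j : A) else 0 := rfl
      simp only [CStarMatrix.mul_apply, CStarMatrix.star_apply, hRapp]
      rw [Finset.sum_eq_single ⟨a₀, ha₀⟩ (fun k _ hk => by simp [hk]) (by simp)]
      simp
    have hpos (M : CStarMatrix w.support w.support A) (hM : 0 ≤ M) :
        0 ≤ RCLike.re (∑ i : w.support, ∑ j : w.support, ⟪σ (M j i) (w i), w j⟫_ℂ) := by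
      rw [StarOrderedRing.nonneg_iff] at hM
      induction hM using AddSubmonoid.closure_induction with
      | mem x hx =>
        obtain ⟨S, rfl⟩ := hx
        -- For a matrix `S⋆S` the form is a sum of squared norms, one for each row of `S`.
        have : ∑ i : w.support, ∑ j : w.support, ⟪σ ((star S * S) j i) (w i), w j⟫_ℂ =
            ∑ k, ⟪∑ i : w.support, σ (S k i) (w i), ∑ i : w.support, σ (S k i) (w i)⟫_ℂ := by
          simp only [CStarMatrix.mul_apply, CStarMatrix.star_apply, map_sum, map_mul, map_star,
            sum_apply, sum_inner, inner_sum, mul_apply_eq_comp,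
            ContinuousLinearMap.star_eq_adjoint, ContinuousLinearMap.adjoint_inner_left]
          rw [Finset.sum_comm]
          conv_rhs => rw [Finset.sum_comm]
          exact Finset.sum_congr rfl fun y _ => Finset.sum_comm
        rw [this, map_sum]
        exact Finset.sum_nonneg fun k _ => inner_self_nonneg
      | zero => simp
      | add x y _ _ hx hy =>
        simpa [inner_add_left, Finset.sum_add_distrib] using add_nonneg hx hy
    have := hpos _ (CompletelyPositiveMap.map_cstarMatrix_nonneg Φ _ (star_mul_self_nonneg R))
    simp only [CStarMatrix.map_apply, hR] at this
    simp only [Finsupp.sum, ← Finset.sum_coe_sort w.support]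
    exact this

end Stinespring

/-! ### Direct sums of representations -/

section HilbertSum

variable {A : Type*} [CStarAlgebra A] {ι : Type*} {G : ι → Type*} [∀ i, NormedAddCommGroup (G i)]
  [∀ i, InnerProductSpace ℂ (G i)] [∀ i, CompleteSpace (G i)]

lemma norm_starAlgHom_apply_le {H : Type*} [NormedAddCommGroup H] [InnerProductSpace ℂ H]
    [CompleteSpace H] (σ : A →⋆ₐ[ℂ] (H →L[ℂ] H)) (a : A) (x : H) : ‖σ a x‖ ≤ ‖a‖ * ‖x‖ :=
  ((σ a).le_opNorm x).trans (by gcongr; exact NonUnitalStarAlgHom.norm_apply_le σ a)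

/-- The direct sum of a family of representations. -/
noncomputable def directSumRep (σ : ∀ i, A →⋆ₐ[ℂ] (G i →L[ℂ] G i)) :
    A →⋆ₐ[ℂ] (lp G 2 →L[ℂ] lp G 2) :=
  have hle (a : A) (f : lp G 2) (i : ι) : ‖σ i a (f i)‖ ≤ ‖((‖a‖ : ℂ) • f) i‖ := by
    rw [lp.coeFn_smul, Pi.smul_apply, norm_smul, Complex.norm_real, norm_norm]
    exact norm_starAlgHom_apply_le (σ i) a (f i)
  let op (a : A) : lp G 2 →L[ℂ] lp G 2 := LinearMap.mkContinuous
    { toFun := fun f => ⟨fun i => σ i a (f i), (lp.memℓp ((‖a‖ : ℂ) • f)).mono' (hle a f)⟩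
      map_add' := fun f g => by ext i; exact map_add (σ i a) _ _
      map_smul' := fun c f => by ext i; exact map_smul (σ i a) _ _ } ‖a‖ fun f => by
        refine (lp.norm_mono (by simp) (hle a f)).trans ?_
        rw [norm_smul, Complex.norm_real, norm_norm]
  have op_apply (a : A) (f : lp G 2) (i : ι) : op a f i = σ i a (f i) := rfl
  { toFun := op
    map_one' := by ext f i; simp [op_apply]
    map_mul' := fun a b => by ext f i; simp [op_apply]
    map_zero' := by ext f i; simp [op_apply]
    map_add' := fun a b => by ext f i; simp [op_apply]
    commutes' := fun r => by ext f i; simp [op_apply, Algebra.algebraMap_eq_smul_one]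
    map_star' := fun a => by
      rw [ContinuousLinearMap.star_eq_adjoint, ContinuousLinearMap.eq_adjoint_iff]
      intro f g
      simp [lp.inner_eq_tsum, op_apply, map_star, ContinuousLinearMap.star_eq_adjoint,
        ContinuousLinearMap.adjoint_inner_left] }

@[simp]
lemma directSumRep_apply (σ : ∀ i, A →⋆ₐ[ℂ] (G i →L[ℂ] G i)) (a : A) (f : lp G 2) (i : ι) :
    directSumRep σ a f i = σ i a (f i) := rfl

lemma directSumRep_single [DecidableEq ι] (σ : ∀ i, A →⋆ₐ[ℂ] (G i →L[ℂ] G i)) (a : A) (i : ι)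
    (x : G i) : directSumRep σ a (lp.single 2 i x) = lp.single 2 i (σ i a x) := by
  ext j
  rcases eq_or_ne j i with rfl | h
  · simp
  · simp [h]

end HilbertSum

/-! ### The weighted shift on a Hilbert sum -/

section Shift

variable {G : ℕ → Type*} [∀ n, NormedAddCommGroup (G n)] [∀ n, InnerProductSpace ℂ (G n)]

/-- The weighted shift `(x₀, x₁, …) ↦ (C x₀, D₀ x₀, D₁ x₁, …)` on a Hilbert sum. -/
noncomputable def shiftOp (C : G 0 →L[ℂ] G 0) (D : ∀ n, G n →L[ℂ] G (n + 1))
    (hD : ∀ n x, ‖D n x‖ ≤ ‖x‖) : lp G 2 →ₗ[ℂ] lp G 2 where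
  toFun f := ⟨fun n => Nat.casesOn n (C (f 0)) fun n => D n (f n), by
    have hf := (lp.memℓp f).summable (by simp)
    refine memℓp_gen ((summable_nat_add_iff 1).1 (hf.of_nonneg_of_le (fun n => by positivity)
      fun n => ?_))
    gcongr
    exact hD n (f n)⟩
  map_add' f g := by
    ext n
    cases n with
    | zero => exact map_add C _ _
    | succ n => exact map_add (D n) _ _
  map_smul' c f := by
    ext n
    cases n with
    | zero => exact map_smul C _ _
    | succ n => exact map_smul (D n) _ _

variable (C : G 0 →L[ℂ] G 0) (D : ∀ n, G n →L[ℂ] G (n + 1)) (hD : ∀ n x, ‖D n x‖ ≤ ‖x‖)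

@[simp]
lemma shiftOp_apply_zero (f : lp G 2) : shiftOp C D hD f 0 = C (f 0) := rfl

@[simp]
lemma shiftOp_apply_succ (f : lp G 2) (n : ℕ) : shiftOp C D hD f (n + 1) = D n (f n) := rfl

lemma shiftOp_single_zero (x : G 0) :
    shiftOp C D hD (lp.single 2 0 x) = lp.single 2 0 (C x) + lp.single 2 1 (D 0 x) := by
  ext n
  match n with
  | 0 => simp
  | 1 => simp
  | n + 2 => simp

lemma shiftOp_single_succ (n : ℕ) (x : G (n + 1)) :
    shiftOp C D hD (lp.single 2 (n + 1) x) = lp.single 2 (n + 2) (D (n + 1) x) := by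
  ext m
  cases m with
  | zero => simp
  | succ m =>
    rcases eq_or_ne m (n + 1) with rfl | h
    · simp
    · simp [h]

/-- This is `V⋆ π(a) V = π(b)` in weak form. Coordinate `0` of the input feeds outputs `0` and `1`,
so two terms are split off on the left and one on the right; the others match after an index shift.
-/
lemma inner_shiftOp_directSumRep {A : Type*} [CStarAlgebra A] [∀ n, CompleteSpace (G n)]
    (σ : ∀ n, A →⋆ₐ[ℂ] (G n →L[ℂ] G n)) (a b : A)
    (h0 : ∀ x y, ⟪C x, σ 0 a (C y)⟫_ℂ + ⟪D 0 x, σ 1 a (D 0 y)⟫_ℂ = ⟪x, σ 0 b y⟫_ℂ)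
    (hs : ∀ n x y, ⟪D (n + 1) x, σ (n + 2) a (D (n + 1) y)⟫_ℂ = ⟪x, σ (n + 1) b y⟫_ℂ)
    (f g : lp G 2) :
    ⟪shiftOp C D hD f, directSumRep σ a (shiftOp C D hD g)⟫_ℂ =
      ⟪f, directSumRep σ b g⟫_ℂ := by
  have h1 := lp.summable_inner (𝕜 := ℂ) (shiftOp C D hD f) (directSumRep σ a (shiftOp C D hD g))
  have h2 := lp.summable_inner (𝕜 := ℂ) f (directSumRep σ b g)
  rw [lp.inner_eq_tsum, lp.inner_eq_tsum, h1.tsum_eq_zero_add, h2.tsum_eq_zero_add,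
    ((summable_nat_add_iff 1).2 h1).tsum_eq_zero_add]
  simp only [directSumRep_apply, shiftOp_apply_zero, shiftOp_apply_succ, hs]
  rw [← add_assoc, h0]

end Shift

/-! ### The GNS space and the defect map -/

section GNS

variable {A : Type*} [CStarAlgebra A] [PartialOrder A] [StarOrderedRing A]

lemma denseRange_gnsVector (φ : A →ₚ[ℂ] ℂ) :
    DenseRange fun a => φ.gnsStarAlgHom a (gnsVector φ) := by
  simp only [gnsStarAlgHom_gnsVector]
  exact UniformSpace.Completion.denseRange_coe.comp φ.toPreGNS.surjective.denseRange
    (UniformSpace.Completion.continuous_coe _)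

lemma isTotal_gnsVector (φ : A →ₚ[ℂ] ℂ) :
    IsTotal (Set.range fun a => φ.gnsStarAlgHom a (gnsVector φ)) :=
  (denseRange_gnsVector φ).mono Submodule.subset_span

lemma inner_gnsVector (φ : A →ₚ[ℂ] ℂ) (a b : A) :
    ⟪φ.gnsStarAlgHom a (gnsVector φ), φ.gnsStarAlgHom b (gnsVector φ)⟫_ℂ = φ (star a * b) := by
  rw [gnsStarAlgHom_gnsVector, gnsStarAlgHom_gnsVector, UniformSpace.Completion.inner_coe,
    PositiveLinearMap.preGNS_inner_def]
  simp

lemma inner_gnsVector_gnsStarAlgHom (φ : A →ₚ[ℂ] ℂ) (a : A) :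
    ⟪gnsVector φ, φ.gnsStarAlgHom a (gnsVector φ)⟫_ℂ = φ a := by
  simpa using inner_gnsVector φ 1 a

variable (Φ : A →CP A) (φ : A →ₚ[ℂ] ℂ) (hΦ : Φ 1 = 1) (hinv : ∀ a, φ (Φ a) = φ a)

lemma adjoint_gnsContraction_gnsVector :
    ContinuousLinearMap.adjoint (gnsContraction Φ φ hΦ hinv) (gnsVector φ) = gnsVector φ := by
  refine (isTotal_gnsVector φ).ext_inner ?_
  rintro _ ⟨a, rfl⟩
  rw [ContinuousLinearMap.adjoint_inner_right, gnsContraction_apply, ← inner_conj_symm,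
    inner_gnsVector_gnsStarAlgHom, hinv, ← inner_gnsVector_gnsStarAlgHom, inner_conj_symm]

/-- The defect map `a ↦ π_φ(Φ(a)) - U π_φ(a) U⋆` of the GNS contraction. -/
noncomputable def defectMap : A →ₗ[ℂ] (φ.GNS →L[ℂ] φ.GNS) where
  toFun a := φ.gnsStarAlgHom (Φ a) - gnsContraction Φ φ hΦ hinv * φ.gnsStarAlgHom a *
    star (gnsContraction Φ φ hΦ hinv)
  map_add' a b := by simp only [map_add]; noncomm_ring
  map_smul' c a := by simp [smul_sub]

lemma defectMap_apply (a : A) : defectMap Φ φ hΦ hinv a =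
    φ.gnsStarAlgHom (Φ a) - gnsContraction Φ φ hΦ hinv * φ.gnsStarAlgHom a *
      star (gnsContraction Φ φ hΦ hinv) := rfl

lemma inner_defectMap (a : A) (x y : φ.GNS) :
    ⟪x, defectMap Φ φ hΦ hinv a y⟫_ℂ = ⟪x, φ.gnsStarAlgHom (Φ a) y⟫_ℂ -
      ⟪ContinuousLinearMap.adjoint (gnsContraction Φ φ hΦ hinv) x,
        φ.gnsStarAlgHom a (ContinuousLinearMap.adjoint (gnsContraction Φ φ hΦ hinv) y)⟫_ℂ := by
  rw [defectMap_apply, sub_apply, inner_sub_right, ContinuousLinearMap.adjoint_inner_left]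
  rfl

end GNS

/-! ### Complete positivity of the defect; stages of the tower -/

section Existence

variable {A : Type u} [CStarAlgebra A] [PartialOrder A] [StarOrderedRing A]
  (Φ : A →CP A) (φ : A →ₚ[ℂ] ℂ) (hΦ : Φ 1 = 1) (hinv : ∀ a, φ (Φ a) = φ a)

/-- Let `(σ, D)` dilate `π_φ ∘ Φ`. Invariance of `φ` makes `π_φ(b) Ω ↦ σ(b) D Ω` isometric, and its
adjoint sends `σ(a) D x` to `π_φ(a) U⋆ x`. The form of the defect is therefore `‖ξ‖² - ‖y‖²` with
`y` the image of `ξ` under a contraction. -/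
lemma posSemidef_starKernel_defectMap :
    (starKernel (defectMap Φ φ hΦ hinv)).PosSemidef := by
  set U := gnsContraction Φ φ hΦ hinv with hU
  have hherm : (starKernel (defectMap Φ φ hΦ hinv)).IsHermitian := by
    ext a b : 1
    change star (defectMap Φ φ hΦ hinv (star b * a)) = defectMap Φ φ hΦ hinv (star a * b)
    have h : Φ (star a * b) = star (Φ (star b * a)) := by
      rw [← cp_map_star, star_mul, star_star]
    simp only [defectMap_apply, star_sub, star_mul, star_star, h, map_star, map_mul, mul_assoc]
  refine ((RKHS.posSemidef_tfae (K := starKernel _)).out 0 2).2 (And.intro hherm fun w => ?_)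
  · obtain ⟨K, _, _, _, σ, D, hσ, -⟩ := exists_stinespring _
      (posSemidef_starKernel_comp Φ φ.gnsStarAlgHom)
    replace hσ (a b : A) (x y : φ.GNS) :
        ⟪σ a (D x), σ b (D y)⟫_ℂ = ⟪x, φ.gnsStarAlgHom (Φ (star a * b)) y⟫_ℂ := by
      rw [inner_starAlgHom_left, starAlgHom_apply_apply, hσ]
      rfl
    let ξ := w.sum fun a x => σ a (D x)
    let y := w.sum fun a x => φ.gnsStarAlgHom a (ContinuousLinearMap.adjoint U x)
    have hnorm (b : A) : ‖σ b (D (gnsVector φ))‖ = ‖φ.gnsStarAlgHom b (gnsVector φ)‖ := by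
      rw [@norm_eq_sqrt_re_inner ℂ, @norm_eq_sqrt_re_inner ℂ φ.GNS, hσ, inner_gnsVector,
        inner_gnsVector_gnsStarAlgHom, hinv]
    have hinner (b : A) :
        ⟪φ.gnsStarAlgHom b (gnsVector φ), y⟫_ℂ = ⟪σ b (D (gnsVector φ)), ξ⟫_ℂ := by
      simp only [y, ξ, Finsupp.inner_sum, hσ]
      refine Finsupp.sum_congr fun a _ => ?_
      rw [← star_star a, ← inner_starAlgHom_left, ContinuousLinearMap.adjoint_inner_right,
        starAlgHom_apply_apply, gnsContraction_apply, inner_starAlgHom_left, ← cp_map_star,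
        star_mul]
    have hle : ‖y‖ ≤ ‖ξ‖ := by
      -- The adjoint is never constructed: Cauchy–Schwarz on the dense orbit of `Ω`, then `z = y`,
      -- yields the contraction estimate.
      have hz (z : φ.GNS) : ‖⟪z, y⟫_ℂ‖ ≤ ‖z‖ * ‖ξ‖ := by
        refine (denseRange_gnsVector φ).induction_on z ?_ fun b => ?_
        · exact isClosed_le (by fun_prop) (by fun_prop)
        · rw [hinner, ← hnorm]
          exact norm_inner_le_norm _ _
      have := hz y
      rw [inner_self_eq_norm_sq_to_K, norm_pow, RCLike.norm_ofReal, abs_norm, sq] at this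
      rcases (norm_nonneg y).eq_or_lt with h0 | h0
      · rw [← h0]; exact norm_nonneg _
      · exact le_of_mul_le_mul_left this h0
    have hsum : (w.sum fun a x => w.sum fun b z =>
        ⟪starKernel (defectMap Φ φ hΦ hinv) b a x, z⟫_ℂ) =
        ⟪ξ, ξ⟫_ℂ - ⟪y, y⟫_ℂ := by
      have hterm (a b : A) (x z : φ.GNS) : ⟪starKernel (defectMap Φ φ hΦ hinv) b a x, z⟫_ℂ =
          ⟪σ a (D x), σ b (D z)⟫_ℂ - ⟪φ.gnsStarAlgHom a (ContinuousLinearMap.adjoint U x),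
            φ.gnsStarAlgHom b (ContinuousLinearMap.adjoint U z)⟫_ℂ := by
        rw [← hherm.apply, ContinuousLinearMap.star_eq_adjoint,
          ContinuousLinearMap.adjoint_inner_left, hσ, inner_starAlgHom_left,
          starAlgHom_apply_apply]
        exact inner_defectMap Φ φ hΦ hinv _ _ _
      simp only [hterm, ξ, y, Finsupp.sum, sum_inner, inner_sum, Finset.sum_sub_distrib]
      congr 1 <;> exact Finset.sum_comm
    rw [hsum, map_sub, inner_self_eq_norm_sq, inner_self_eq_norm_sq, sub_nonneg]
    gcongr

/-- A Hilbert space with a representation of `A` and a completely positive map to be dilated. -/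
structure Stage (A : Type u) [CStarAlgebra A] : Type (u + 1) where
  /-- The underlying Hilbert space. -/
  space : Type u
  [normedAddCommGroup : NormedAddCommGroup space]
  [innerProductSpace : InnerProductSpace ℂ space]
  [completeSpace : CompleteSpace space]
  /-- The representation. -/
  rep : A →⋆ₐ[ℂ] (space →L[ℂ] space)
  /-- The completely positive map to be dilated. -/
  cp : A →ₗ[ℂ] (space →L[ℂ] space)
  posSemidef : (starKernel cp).PosSemidef

attribute [instance] Stage.normedAddCommGroup Stage.innerProductSpace Stage.completeSpace

lemma Stage.exists_next (S : Stage A) : ∃ (S' : Stage A) (D : S.space →L[ℂ] S'.space),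
    (∀ a, S'.cp a = S'.rep (Φ a)) ∧ (∀ a x y, ⟪D x, S'.rep a (D y)⟫_ℂ = ⟪x, S.cp a y⟫_ℂ) ∧
    IsTotal (Set.range fun p : A × S.space => S'.rep p.1 (D p.2)) := by
  obtain ⟨K, _, _, _, σ, D, hD, htot⟩ := exists_stinespring S.cp S.posSemidef
  exact ⟨⟨K, σ, _, posSemidef_starKernel_comp Φ σ⟩, D, fun _ => rfl, hD, htot⟩

end Existence

/-! ### Dilation from covariance -/

section Covariant

variable {A : Type*} [CStarAlgebra A] [PartialOrder A] [StarOrderedRing A]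
  {H : Type*} [NormedAddCommGroup H] [InnerProductSpace ℂ H] [CompleteSpace H]
  {Φ : A →CP A} {φ : A →ₚ[ℂ] ℂ} {hΦ : Φ 1 = 1} {hinv : ∀ a, φ (Φ a) = φ a}

/-- Since `V⋆ π(a) Ω = V⋆ π(a) V Ω = π(Φ a) Ω`, one has `V⋆ Z = Z U`. Iterating, taking adjoints and
using `Z⋆ Z = 1` gives the claim. -/
lemma isIsometricDilation_of_extendsGNS {Z : φ.GNS →ₗᵢ[ℂ] H} {π : A →⋆ₐ[ℂ] (H →L[ℂ] H)} {Ω : H}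
    {V : H →L[ℂ] H} (hZ : ExtendsGNS φ Z π Ω) (hV : Isometry V) (hVΩ : V Ω = Ω)
    (hcov : ∀ a, π (Φ a) = star V * π a * V) :
    IsIsometricDilation (ContinuousLinearMap.adjoint (gnsContraction Φ φ hΦ hinv)) Z V := by
  refine ⟨hV, fun n => ?_⟩
  set U := gnsContraction Φ φ hΦ hinv with hU
  set Z' := Z.toContinuousLinearMap with hZ'
  have hint (a : A) (x : φ.GNS) : π a (Z' x) = Z' (φ.gnsStarAlgHom a x) :=
    congrArg (fun T : φ.GNS →L[ℂ] H => T x) (hZ.intertwines a)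
  have hΩ : Z' (gnsVector φ) = Ω := hZ.vector_eq.symm
  have hcomm : star V ∘L Z' = Z' ∘L U := by
    refine (isTotal_gnsVector φ).clm_ext ?_
    rintro _ ⟨a, rfl⟩
    simp only [ContinuousLinearMap.comp_apply]
    rw [gnsContraction_apply, ← hint, ← hint, hΩ, hcov]
    simp [hVΩ]
  have hpow : (star V ^ n) ∘L Z' = Z' ∘L (U ^ n) := by
    induction n with
    | zero => rfl
    | succ n ih =>
      calc (star V ^ (n + 1)) ∘L Z' = (star V ^ n) ∘L (star V ∘L Z') := by rw [pow_succ]; rfl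
        _ = ((star V ^ n) ∘L Z') ∘L U := by rw [hcomm]; rfl
        _ = Z' ∘L (U ^ (n + 1)) := by rw [ih, pow_succ]; rfl
  have hadj := congrArg ContinuousLinearMap.adjoint hpow
  rw [ContinuousLinearMap.adjoint_comp, ContinuousLinearMap.adjoint_comp,
    ← ContinuousLinearMap.star_eq_adjoint (A := star V ^ n), star_pow, star_star,
    ← ContinuousLinearMap.star_eq_adjoint (A := U ^ n), star_pow] at hadj
  rw [← ContinuousLinearMap.comp_assoc, hadj, ContinuousLinearMap.comp_assoc,
    Z'.norm_map_iff_adjoint_comp_self.1 Z.norm_map]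
  rfl

end Covariant

/-! ### Cyclicity for the orbit algebra -/

section Cyclic

variable {A : Type*} [CStarAlgebra A] {H : Type*} [NormedAddCommGroup H] [InnerProductSpace ℂ H]
  [CompleteSpace H] {π : A →⋆ₐ[ℂ] (H →L[ℂ] H)} {V : H →L[ℂ] H} {Ω : H}

lemma star_mul_self_of_isometry (hV : Isometry V) : star V * V = 1 :=
  V.norm_map_iff_adjoint_comp_self.1 (AddMonoidHomClass.isometry_iff_norm V |>.1 hV)

lemma mem_orbitAlgebra (n : ℕ) (a : A) : V ^ n * π a * star V ^ n ∈ orbitAlgebra π V :=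
  StarAlgebra.subset_adjoin ℂ _ ⟨n, a, rfl⟩

lemma apply_mem_orbitAlgebra (a : A) : π a ∈ orbitAlgebra π V := by
  simpa using mem_orbitAlgebra (π := π) (V := V) 0 a

/-- Because `V⋆ V = 1`, the map `T ↦ V T V⋆` is multiplicative, and it raises the exponent of each
generator by one. It is not unital: scalars go to generators of exponent one. -/
lemma conj_mem_orbitAlgebra (hV : Isometry V) {T : H →L[ℂ] H} (hT : T ∈ orbitAlgebra π V) :
    V * T * star V ∈ orbitAlgebra π V := by
  induction hT using StarAlgebra.adjoin_induction with
  | mem T hT =>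
    obtain ⟨n, a, rfl⟩ := hT
    have := mem_orbitAlgebra (π := π) (V := V) (n + 1) a
    rw [pow_succ', pow_succ (star V)] at this
    simpa only [mul_assoc] using this
  | algebraMap r =>
    have := mem_orbitAlgebra (π := π) (V := V) 1 (algebraMap ℂ A r)
    simpa [AlgHomClass.commutes] using this
  | add S T _ _ hS hT => simpa only [mul_add, add_mul] using add_mem hS hT
  | mul S T _ _ hS hT =>
    have := mul_mem hS hT
    rwa [show V * S * star V * (V * T * star V) = V * S * (star V * V) * T * star V by noncomm_ring,
      star_mul_self_of_isometry hV, mul_one, mul_assoc V] at this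
  | star T _ hT => simpa [mul_assoc] using star_mem hT

/-- `Ω` is cyclic for the orbit algebra as soon as no proper closed subspace containing `Ω` is
invariant under the representation and the isometry. -/
lemma isCyclic_of_forall_submodule (hV : Isometry V) (hVΩ : V Ω = Ω)
    (h : ∀ M : Submodule ℂ H, IsClosed (M : Set H) → Ω ∈ M → (∀ a, ∀ x ∈ M, π a x ∈ M) →
      (∀ x ∈ M, V x ∈ M) → M = ⊤) :
    IsCyclic (orbitAlgebra π V) Ω := by
  let N : Submodule ℂ H := (Subalgebra.toSubmodule (orbitAlgebra π V).toSubalgebra).map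
    (ContinuousLinearMap.apply ℂ H Ω).toLinearMap
  have hN (x : H) : x ∈ N ↔ ∃ T ∈ orbitAlgebra π V, T Ω = x := Iff.rfl
  have hVΩ' : star V Ω = Ω := by
    conv_lhs => rw [← hVΩ, ← mul_apply_eq_comp, star_mul_self_of_isometry hV]
    rfl
  have hmap (S : H →L[ℂ] H) (hS : ∀ x ∈ N, S x ∈ N) :
      ∀ x ∈ N.topologicalClosure, S x ∈ N.topologicalClosure :=
    fun x hx => map_mem_closure S.continuous hx hS
  have htop := h N.topologicalClosure N.isClosed_topologicalClosure
    (N.le_topologicalClosure ((hN _).2 ⟨1, one_mem _, rfl⟩))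
    (fun a => hmap _ ?_) (hmap _ ?_)
  · rw [← Submodule.dense_iff_topologicalClosure_eq_top] at htop
    refine htop.mono ?_
    rintro x hx
    obtain ⟨T, hT, rfl⟩ := (hN x).1 hx
    exact ⟨T, hT, rfl⟩
  · intro x hx
    obtain ⟨T, hT, rfl⟩ := (hN x).1 hx
    exact (hN _).2 ⟨π a * T, mul_mem (apply_mem_orbitAlgebra a) hT, rfl⟩
  · intro x hx
    obtain ⟨T, hT, rfl⟩ := (hN x).1 hx
    -- `V` itself need not lie in the algebra, but `V⋆ Ω = Ω` gives `V T Ω = (V T V⋆) Ω`.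
    refine (hN _).2 ⟨V * T * star V, conj_mem_orbitAlgebra hV hT, ?_⟩
    simp [hVΩ']

end Cyclic

/-! ### The isometry of a tower -/

section Sequence

variable {A : Type*} [CStarAlgebra A] {G : ℕ → Type*} [∀ n, NormedAddCommGroup (G n)]
  [∀ n, InnerProductSpace ℂ (G n)] [∀ n, CompleteSpace (G n)]

/-- The covariant isometry on the Hilbert sum of a tower of dilations. -/
theorem exists_isometry_of_tower (Φ : A → A) (hΦ : Φ 1 = 1)
    (σ : ∀ n, A →⋆ₐ[ℂ] (G n →L[ℂ] G n)) (C : G 0 →L[ℂ] G 0) (D : ∀ n, G n →L[ℂ] G (n + 1))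
    (h0 : ∀ a x y, ⟪C x, σ 0 a (C y)⟫_ℂ + ⟪D 0 x, σ 1 a (D 0 y)⟫_ℂ = ⟪x, σ 0 (Φ a) y⟫_ℂ)
    (hs : ∀ n a x y, ⟪D (n + 1) x, σ (n + 2) a (D (n + 1) y)⟫_ℂ = ⟪x, σ (n + 1) (Φ a) y⟫_ℂ)
    (htot : ∀ n, IsTotal (Set.range fun p : A × G n => σ (n + 1) p.1 (D n p.2)))
    (ω : G 0) (hω : IsTotal (Set.range fun a => σ 0 a ω)) (hC : C ω = ω) :
    ∃ V : lp G 2 →L[ℂ] lp G 2, Isometry V ∧ V (lp.single 2 0 ω) = lp.single 2 0 ω ∧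
      (∀ a, directSumRep σ (Φ a) = star V * directSumRep σ a * V) ∧
      IsCyclic (orbitAlgebra (directSumRep σ) V) (lp.single 2 0 ω) := by
  have hnorm0 (x : G 0) : ‖C x‖ ^ 2 + ‖D 0 x‖ ^ 2 = ‖x‖ ^ 2 := by
    have := h0 1 x x
    simp only [hΦ, map_one, one_apply_eq_self, inner_self_eq_norm_sq_to_K] at this
    exact_mod_cast this
  have hnorms (n : ℕ) (x : G (n + 1)) : ‖D (n + 1) x‖ ^ 2 = ‖x‖ ^ 2 := by
    have := hs n 1 x x
    simp only [hΦ, map_one, one_apply_eq_self, inner_self_eq_norm_sq_to_K] at this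
    exact_mod_cast this
  have hD (n : ℕ) (x : G n) : ‖D n x‖ ≤ ‖x‖ := by
    refine le_of_sq_le_sq ?_ (norm_nonneg x)
    cases n with
    | zero => rw [← hnorm0]; exact le_add_of_nonneg_left (by positivity)
    | succ n => exact (hnorms n x).le
  -- `C` already preserves the norm of `ω`, so nothing is left for the defect.
  have hDω : D 0 ω = 0 := by
    have := hnorm0 ω
    rwa [hC, add_eq_left, sq_eq_zero_iff, norm_eq_zero] at this
  have hinner (a : A) (f g : lp G 2) := inner_shiftOp_directSumRep C D hD σ a (Φ a) (h0 a)
    (fun n => hs n a) f g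
  let V : lp G 2 →L[ℂ] lp G 2 := ((shiftOp C D hD).isometryOfInner fun f g => by
    simpa [hΦ] using hinner 1 f g).toContinuousLinearMap
  have hVapp (f : lp G 2) : V f = shiftOp C D hD f := rfl
  have hiso : Isometry V := LinearIsometry.isometry _
  have hVω : V (lp.single 2 0 ω) = lp.single 2 0 ω := by
    rw [hVapp, shiftOp_single_zero, hC, hDω, lp.single_zero, add_zero]
  refine ⟨V, hiso, hVω, fun a => ?_, isCyclic_of_forall_submodule hiso hVω fun M hM hωM hπ hV => ?_⟩
  · refine ContinuousLinearMap.ext fun g => ext_inner_left ℂ fun f => ?_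
    rw [← hinner a f g, ContinuousLinearMap.star_eq_adjoint, mul_apply_eq_comp, mul_apply_eq_comp,
      ContinuousLinearMap.adjoint_inner_right]
    rfl
  · have hcomap (n : ℕ) {s : Set (G n)} (hs : IsTotal s) (h : ∀ x ∈ s, lp.single 2 n x ∈ M)
        (x : G n) : lp.single 2 n x ∈ M := by
      have := hs.induction (M.comap (lp.singleContinuousLinearMap ℂ G 2 n).toLinearMap)
        (hM.preimage (lp.singleContinuousLinearMap ℂ G 2 n).continuous) h
      exact (this ▸ Submodule.mem_top : x ∈ M.comap
        (lp.singleContinuousLinearMap ℂ G 2 n).toLinearMap)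
    have hmem (n : ℕ) : ∀ x : G n, lp.single 2 n x ∈ M := by
      induction n with
      | zero =>
        refine hcomap 0 hω ?_
        rintro _ ⟨a, rfl⟩
        rw [← directSumRep_single]
        exact hπ a _ hωM
      | succ n ih =>
        refine hcomap (n + 1) (htot n) ?_
        rintro _ ⟨⟨a, x⟩, rfl⟩
        rw [← directSumRep_single]
        refine hπ a _ ?_
        have hVx := hV _ (ih x)
        rw [hVapp] at hVx
        cases n with
        | zero =>
          rw [shiftOp_single_zero] at hVx
          -- Only at level zero does the shift leave a component in place; it lies in `M` by
          -- induction and is subtracted.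
          exact (M.add_mem_iff_right (ih _)).1 hVx
        | succ n => rwa [shiftOp_single_succ] at hVx
    rw [eq_top_iff]
    intro f _
    exact hM.mem_of_tendsto (lp.hasSum_single (by simp) f)
      (Filter.Eventually.of_forall fun s => M.sum_mem fun n _ => hmem n _)

end Sequence

/-! ### Construction of the quadruple -/

section Existence

variable {A : Type u} [CStarAlgebra A] [PartialOrder A] [StarOrderedRing A]

/-- Iterated Stinespring dilation, starting from an isomorphic copy of a given stage. -/
lemma Stage.exists_tower (Φ : A →CP A) (S₀ : Stage A) :
    ∃ (S : ℕ → Stage A) (D : ∀ n, (S n).space →L[ℂ] (S (n + 1)).space)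
      (e : S₀.space ≃ₗᵢ[ℂ] (S 0).space),
      (∀ a x, (S 0).rep a (e x) = e (S₀.rep a x)) ∧
      (∀ a x y, ⟪D 0 (e x), (S 1).rep a (D 0 (e y))⟫_ℂ = ⟪x, S₀.cp a y⟫_ℂ) ∧
      (∀ n a x y, ⟪D (n + 1) x, (S (n + 2)).rep a (D (n + 1) y)⟫_ℂ =
        ⟪x, (S (n + 1)).rep (Φ a) y⟫_ℂ) ∧
      ∀ n, IsTotal (Set.range fun p : A × (S n).space => (S (n + 1)).rep p.1 (D n p.2)) := by
  -- The equality `S 0 = S₀` is eliminated here; users of the tower see only the isometry `e`, with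
  -- no transport along an equality of spaces.
  obtain ⟨S, rfl, hS⟩ : ∃ S : ℕ → Stage A, S 0 = S₀ ∧
      ∀ n, ∃ D : (S n).space →L[ℂ] (S (n + 1)).space,
        (∀ a, (S (n + 1)).cp a = (S (n + 1)).rep (Φ a)) ∧
        (∀ a x y, ⟪D x, (S (n + 1)).rep a (D y)⟫_ℂ = ⟪x, (S n).cp a y⟫_ℂ) ∧
        IsTotal (Set.range fun p : A × (S n).space => (S (n + 1)).rep p.1 (D p.2)) := by
    choose next hnext using Stage.exists_next (A := A) Φ
    exact ⟨fun n => Nat.rec S₀ (fun _ => next) n, rfl, fun n => hnext _⟩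
  choose D hcp hD htot using hS
  refine ⟨S, D, .refl ℂ _, fun _ _ => rfl, hD 0, fun n a x y => ?_, htot⟩
  rw [hD, hcp]

/-- Existence of the covariant GNS quadruple. -/
theorem exists_covariant (Φ : A →CP A) (φ : A →ₚ[ℂ] ℂ) (hΦ : Φ 1 = 1)
    (hinv : ∀ a, φ (Φ a) = φ a) :
    ∃ (H : Type u) (_ : NormedAddCommGroup H) (_ : InnerProductSpace ℂ H) (_ : CompleteSpace H)
      (Z : φ.GNS →ₗᵢ[ℂ] H) (π : A →⋆ₐ[ℂ] (H →L[ℂ] H)) (Ω : H) (V : H →L[ℂ] H),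
      ExtendsGNS φ Z π Ω ∧ IsCovariant Φ φ hΦ hinv Z π Ω V := by
  obtain ⟨S, D, e, he, hD0, hDs, htot⟩ : ∃ (S : ℕ → Stage A)
      (D : ∀ n, (S n).space →L[ℂ] (S (n + 1)).space) (e : φ.GNS ≃ₗᵢ[ℂ] (S 0).space),
      (∀ a x, (S 0).rep a (e x) = e (φ.gnsStarAlgHom a x)) ∧
      (∀ a x y, ⟪D 0 (e x), (S 1).rep a (D 0 (e y))⟫_ℂ = ⟪x, defectMap Φ φ hΦ hinv a y⟫_ℂ) ∧
      (∀ n a x y, ⟪D (n + 1) x, (S (n + 2)).rep a (D (n + 1) y)⟫_ℂ =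
        ⟪x, (S (n + 1)).rep (Φ a) y⟫_ℂ) ∧
      ∀ n, IsTotal (Set.range fun p : A × (S n).space => (S (n + 1)).rep p.1 (D n p.2)) :=
    Stage.exists_tower Φ ⟨φ.GNS, φ.gnsStarAlgHom, _, posSemidef_starKernel_defectMap Φ φ hΦ hinv⟩
  let σ (n : ℕ) := (S n).rep
  let C : (S 0).space →L[ℂ] (S 0).space := e.toContinuousLinearEquiv.toContinuousLinearMap ∘L
    ContinuousLinearMap.adjoint (gnsContraction Φ φ hΦ hinv) ∘L
    e.symm.toContinuousLinearEquiv.toContinuousLinearMap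
  have hC (x : φ.GNS) :
      C (e x) = e (ContinuousLinearMap.adjoint (gnsContraction Φ φ hΦ hinv) x) := by
    simp [C]
  obtain ⟨V, hV, hVΩ, hcov, hcyc⟩ := exists_isometry_of_tower (G := fun n => (S n).space) Φ hΦ
    σ C D
    (fun a x y => by
      obtain ⟨x, rfl⟩ := e.surjective x
      obtain ⟨y, rfl⟩ := e.surjective y
      rw [hC, hC, he, he, hD0, inner_defectMap, e.inner_map_map, e.inner_map_map]
      abel)
    hDs htot (e (gnsVector φ))
    (by
      have := e.surjective.denseRange.comp (denseRange_gnsVector φ) e.continuous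
      refine this.mono (subset_trans ?_ Submodule.subset_span)
      rintro _ ⟨a, rfl⟩
      exact ⟨a, he a _⟩)
    (by rw [hC, adjoint_gnsContraction_gnsVector])
  let Z : φ.GNS →ₗᵢ[ℂ] lp (fun n => (S n).space) 2 :=
    { toLinearMap := lp.lsingle (𝕜 := ℂ) (E := fun n => (S n).space) 2 0 ∘ₗ e.toLinearMap
      norm_map' := fun x => (lp.norm_single (E := fun n => (S n).space) (by simp) 0 (e x)).trans
        (e.norm_map x) }
  have hZπ (a : A) (x : φ.GNS) : directSumRep σ a (Z x) = Z (φ.gnsStarAlgHom a x) :=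
    (directSumRep_single σ a 0 (e x)).trans (congrArg (lp.single 2 0) (he a x))
  have hZ : ExtendsGNS φ Z (directSumRep σ) (Z (gnsVector φ)) :=
    ⟨fun a => ContinuousLinearMap.ext fun x => hZπ a x, rfl⟩
  refine ⟨lp (fun n => (S n).space) 2, inferInstance, inferInstance, inferInstance, Z,
    directSumRep σ, Z (gnsVector φ), V, hZ, ?_⟩
  exact
    { dilation := isIsometricDilation_of_extendsGNS hZ hV hVΩ hcov
      fixes := hVΩ
      cyclic := hcyc
      covariant := hcov
      state_eq := fun a => by
        rw [hZπ, Z.inner_map_map, inner_gnsVector_gnsStarAlgHom] }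

end Existence

/-! ### Words, compression and uniqueness -/

section Uniqueness

variable {A : Type*} [CStarAlgebra A] {H : Type*} [NormedAddCommGroup H] [InnerProductSpace ℂ H]
  [CompleteSpace H]

/-- The product of the operators `V ^ n π(a) V⋆ ^ n` along a word of pairs `(n, a)`. -/
noncomputable def wordOp (π : A →⋆ₐ[ℂ] (H →L[ℂ] H)) (V : H →L[ℂ] H) (w : List (ℕ × A)) :
    H →L[ℂ] H :=
  (w.map fun p => V ^ p.1 * π p.2 * star V ^ p.1).prod

/-- The word representing the compression `V⋆ (π(a) w) V` of a word with a leading letter. -/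
def compressWord (Φ : A → A) : A → List (ℕ × A) → List (ℕ × A)
  | a, [] => [(0, Φ a)]
  | a, (0, b) :: w => compressWord Φ (a * b) w
  | a, (n + 1, b) :: w => (0, Φ a) :: (n, b) :: compressWord Φ 1 w

variable {π : A →⋆ₐ[ℂ] (H →L[ℂ] H)} {V : H →L[ℂ] H} {Ω : H}

lemma wordOp_nil : wordOp π V [] = 1 := rfl

lemma wordOp_cons (n : ℕ) (a : A) (w : List (ℕ × A)) :
    wordOp π V ((n, a) :: w) = V ^ n * π a * star V ^ n * wordOp π V w := by
  simp [wordOp]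

lemma wordOp_append (w w' : List (ℕ × A)) :
    wordOp π V (w ++ w') = wordOp π V w * wordOp π V w' := by
  simp [wordOp]

lemma star_wordOp (w : List (ℕ × A)) :
    star (wordOp π V w) = wordOp π V (w.map fun p => (p.1, star p.2)).reverse := by
  induction w with
  | nil => simp [wordOp]
  | cons p w ih =>
    obtain ⟨n, a⟩ := p
    rw [wordOp_cons, star_mul, ih, List.map_cons, List.reverse_cons, wordOp_append, wordOp_cons,
      wordOp_nil, mul_one]
    simp [star_pow, mul_assoc, map_star]

/-- A letter of level zero is absorbed into `a`. At a letter of level `n + 1` the product splits as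
`(V⋆ π(a) V) (Vⁿ π(b) V⋆ⁿ) (V⋆ w V)`, and the recursion continues on `w` with leading letter `1`. -/
lemma wordOp_compressWord {Φ : A → A}
    (hcov : ∀ a, π (Φ a) = star V * π a * V) (w : List (ℕ × A)) (a : A) :
    star V * (π a * wordOp π V w) * V = wordOp π V (compressWord Φ a w) := by
  induction w generalizing a with
  | nil => simp [compressWord, wordOp, hcov]
  | cons p w ih =>
    match p with
    | (0, b) =>
      rw [compressWord, ← ih, wordOp_cons, map_mul]
      simp [mul_assoc]
    | (n + 1, b) =>
      rw [compressWord, wordOp_cons, wordOp_cons, wordOp_cons, ← ih, hcov, pow_succ', pow_succ,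
        map_one]
      simp [mul_assoc]

lemma level_compressWord (Φ : A → A) {N : ℕ} (w : List (ℕ × A)) (a : A)
    (hw : ∀ p ∈ w, p.1 ≤ N + 1) : ∀ p ∈ compressWord Φ a w, p.1 ≤ N := by
  induction w generalizing a with
  | nil => simp [compressWord]
  | cons p w ih =>
    have hw' : ∀ p ∈ w, p.1 ≤ N + 1 := fun q hq => hw q (List.mem_cons_of_mem _ hq)
    match p with
    | (0, b) => exact ih _ hw'
    | (n + 1, b) =>
      intro q hq
      simp only [compressWord, List.mem_cons] at hq
      rcases hq with rfl | rfl | hq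
      · simp
      · simpa using hw (n + 1, b) (by simp)
      · exact ih _ hw' q hq

lemma wordOp_eq_of_level_zero (w : List (ℕ × A)) (hw : ∀ p ∈ w, p.1 = 0) :
    wordOp π V w = π (w.map Prod.snd).prod := by
  induction w with
  | nil => simp [wordOp]
  | cons p w ih =>
    obtain ⟨n, a⟩ := p
    obtain rfl : n = 0 := hw (n, a) (by simp)
    rw [wordOp_cons, ih fun q hq => hw q (List.mem_cons_of_mem _ hq)]
    simp

lemma apply_wordOp (hV : star V * V = 1) (hVΩ : V Ω = Ω) (w : List (ℕ × A)) :
    V (wordOp π V w Ω) = wordOp π V (w.map fun p => (p.1 + 1, p.2)) Ω := by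
  induction w with
  | nil => simpa [wordOp] using hVΩ
  | cons p w ih =>
    obtain ⟨n, a⟩ := p
    have hconj : V ^ (n + 1) * π a * star V ^ (n + 1) * V = V * (V ^ n * π a * star V ^ n) := by
      rw [pow_succ', pow_succ]
      simp only [mul_assoc, hV, mul_one]
    rw [List.map_cons, wordOp_cons, wordOp_cons, mul_apply_eq_comp _ (wordOp π V w),
      mul_apply_eq_comp _ (wordOp π V _), ← ih]
    exact congrArg (fun T : H →L[ℂ] H => T (wordOp π V w Ω)) hconj.symm

/-- The span of the words is already a star algebra: products are concatenations, adjoints are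
reversals, and the empty word is `1`. -/
lemma isTotal_wordOp (hcyc : IsCyclic (orbitAlgebra π V) Ω) :
    IsTotal (Set.range fun w => wordOp π V w Ω) := by
  have hspan (T : H →L[ℂ] H) (hT : T ∈ orbitAlgebra π V) :
      T ∈ Submodule.span ℂ (Set.range (wordOp π V)) := by
    induction hT using StarAlgebra.adjoin_induction with
    | mem T hT =>
      obtain ⟨n, a, rfl⟩ := hT
      exact Submodule.subset_span ⟨[(n, a)], by simp [wordOp]⟩
    | algebraMap r =>
      rw [Algebra.algebraMap_eq_smul_one]
      exact Submodule.smul_mem _ _ (Submodule.subset_span ⟨[], rfl⟩)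
    | add S T _ _ hS hT => exact add_mem hS hT
    | mul S T _ _ hS hT =>
      have := Submodule.mul_mem_mul hS hT
      rw [Submodule.span_mul_span] at this
      refine Submodule.span_mono ?_ this
      rintro _ ⟨_, ⟨w, rfl⟩, _, ⟨w', rfl⟩, rfl⟩
      exact ⟨w ++ w', wordOp_append w w'⟩
    | star T hT' hT =>
      clear hT'
      induction hT using Submodule.span_induction with
      | mem T hT =>
        obtain ⟨w, rfl⟩ := hT
        exact Submodule.subset_span ⟨_, (star_wordOp w).symm⟩
      | zero => simp
      | add S T _ _ hS hT => rw [star_add]; exact add_mem hS hT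
      | smul c T _ hT => rw [star_smul]; exact Submodule.smul_mem _ _ hT
  refine hcyc.mono ?_
  rintro x ⟨T, hT, rfl⟩
  have := Submodule.mem_map_of_mem (f := (ContinuousLinearMap.apply ℂ H Ω).toLinearMap) (hspan T hT)
  rw [Submodule.map_span, ← Set.range_comp] at this
  exact this

variable {H' : Type*} [NormedAddCommGroup H'] [InnerProductSpace ℂ H'] [CompleteSpace H']
  {π' : A →⋆ₐ[ℂ] (H' →L[ℂ] H')} {V' : H' →L[ℂ] H'} {Ω' : H'}
  [PartialOrder A] [StarOrderedRing A] {Φ : A →CP A} {φ : A →ₚ[ℂ] ℂ} {hΦ : Φ 1 = 1}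
  {hinv : ∀ a, φ (Φ a) = φ a} {Z : φ.GNS →ₗᵢ[ℂ] H} {Z' : φ.GNS →ₗᵢ[ℂ] H'}

lemma IsCovariant.inner_wordOp_compress (h : IsCovariant Φ φ hΦ hinv Z π Ω V) (w : List (ℕ × A)) :
    ⟪Ω, wordOp π V w Ω⟫_ℂ = ⟪Ω, wordOp π V (compressWord Φ 1 w) Ω⟫_ℂ := by
  rw [← wordOp_compressWord h.covariant, map_one,
    one_mul, mul_apply_eq_comp, mul_apply_eq_comp, h.fixes, ContinuousLinearMap.star_eq_adjoint,
    ContinuousLinearMap.adjoint_inner_right, h.fixes]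

lemma IsCovariant.inner_wordOp_eq (h : IsCovariant Φ φ hΦ hinv Z π Ω V)
    (h' : IsCovariant Φ φ hΦ hinv Z' π' Ω' V') (N : ℕ) (w : List (ℕ × A))
    (hw : ∀ p ∈ w, p.1 ≤ N) : ⟪Ω, wordOp π V w Ω⟫_ℂ = ⟪Ω', wordOp π' V' w Ω'⟫_ℂ := by
  induction N generalizing w with
  | zero =>
    have hw0 : ∀ p ∈ w, p.1 = 0 := fun p hp => Nat.le_zero.1 (hw p hp)
    rw [wordOp_eq_of_level_zero w hw0, wordOp_eq_of_level_zero w hw0, ← h.state_eq, ← h'.state_eq]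
  | succ N ih =>
    rw [h.inner_wordOp_compress, h'.inner_wordOp_compress]
    exact ih _ (level_compressWord _ w 1 hw)

/-- Any two covariant GNS quadruples are unitarily equivalent. -/
theorem IsCovariant.exists_unitary (h : IsCovariant Φ φ hΦ hinv Z π Ω V)
    (h' : IsCovariant Φ φ hΦ hinv Z' π' Ω' V') :
    ∃ W : H ≃ₗᵢ[ℂ] H', W Ω = Ω' ∧ (∀ a x, W (π a x) = π' a (W x)) ∧
      ∀ x, W (V x) = V' (W x) := by
  have htot := isTotal_wordOp h.cyclic
  obtain ⟨W, hW⟩ := exists_linearIsometryEquiv_of_inner_eq htot (isTotal_wordOp h'.cyclic)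
    fun w w' => by
      -- A Gram entry is the vacuum expectation of the single word `w⋆ w'`; the sum of its levels
      -- serves as the bound on each level.
      rw [← ContinuousLinearMap.adjoint_inner_right, ← ContinuousLinearMap.adjoint_inner_right,
        ← ContinuousLinearMap.star_eq_adjoint, ← ContinuousLinearMap.star_eq_adjoint, star_wordOp,
        star_wordOp, ← mul_apply_eq_comp, ← mul_apply_eq_comp, ← wordOp_append, ← wordOp_append]
      exact h.inner_wordOp_eq h' _ _ fun p hp =>
        List.single_le_sum (l := List.map Prod.fst _) (by simp) _ (List.mem_map_of_mem hp)
  let Wc : H →L[ℂ] H' := W.toContinuousLinearEquiv.toContinuousLinearMap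
  have hπ (a : A) : Wc ∘L π a = π' a ∘L Wc := htot.clm_ext (by
    rintro _ ⟨w, rfl⟩
    have hcons {K : Type _} [NormedAddCommGroup K] [InnerProductSpace ℂ K] [CompleteSpace K]
        (ρ : A →⋆ₐ[ℂ] (K →L[ℂ] K)) (S : K →L[ℂ] K) (x : K) :
        ρ a (wordOp ρ S w x) = wordOp ρ S ((0, a) :: w) x := by
      rw [wordOp_cons]; simp
    change W (π a _) = π' a (W _)
    rw [hcons, hW, hW]
    simp [wordOp_cons])
  have hV : Wc ∘L V = V' ∘L Wc := htot.clm_ext (by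
    rintro _ ⟨w, rfl⟩
    change W (V _) = V' (W _)
    rw [apply_wordOp (star_mul_self_of_isometry h.dilation.isometry) h.fixes, hW, hW,
      apply_wordOp (star_mul_self_of_isometry h'.dilation.isometry) h'.fixes])
  exact ⟨W, hW [], fun a x => congrArg (fun T : H →L[ℂ] H' => T x) (hπ a),
    fun x => congrArg (fun T : H →L[ℂ] H' => T x) hV⟩

end Uniqueness

end CovariantGNS

theorem theorem1 {A : Type u} [CStarAlgebra A] [PartialOrder A] [StarOrderedRing A]
    (Φ : A →CP A) (hΦ : Φ 1 = 1) (φ : A →ₚ[ℂ] ℂ) (hφ : φ 1 = 1)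
    (hinv : ∀ a, φ (Φ a) = φ a) :
    ∃ (H : Type u) (_ : NormedAddCommGroup H) (_ : InnerProductSpace ℂ H) (_ : CompleteSpace H)
      (Z : φ.GNS →ₗᵢ[ℂ] H) (π : A →⋆ₐ[ℂ] (H →L[ℂ] H)) (Ω : H) (V : H →L[ℂ] H),
      CovariantGNS.ExtendsGNS φ Z π Ω ∧
      CovariantGNS.IsCovariant Φ φ hΦ hinv Z π Ω V ∧
      ∀ (H' : Type v) [NormedAddCommGroup H'] [InnerProductSpace ℂ H'] [CompleteSpace H']
        (Z' : φ.GNS →ₗᵢ[ℂ] H') (π' : A →⋆ₐ[ℂ] (H' →L[ℂ] H')) (Ω' : H') (V' : H' →L[ℂ] H'),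
        CovariantGNS.IsCovariant Φ φ hΦ hinv Z' π' Ω' V' →
        ∃ W : H ≃ₗᵢ[ℂ] H', W Ω = Ω' ∧ (∀ a x, W (π a x) = π' a (W x)) ∧
          ∀ x, W (V x) = V' (W x) := by
  obtain ⟨H, _, _, _, Z, π, Ω, V, hZ, hcov⟩ := CovariantGNS.exists_covariant Φ φ hΦ hinv
  exact ⟨H, _, _, _, Z, π, Ω, V, hZ, hcov, fun H' _ _ _ Z' π' Ω' V' h' => hcov.exists_unitary h'⟩
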